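/- Let $X$ be a set, $\mathcal F$ a collection of subsets of $X$, $Y\subseteq X$, and $\mathscr U$ an ultrafilter on $Y$. Put $$Y_{\mathcal F}(\mathscr U):=\{x\in X:\ \text{for every } F\in\mathcal F,\ x\in F \iff F\cap Y\in\mathscr U\}.$$ A subset $Y$ of $X$ is called $\mathcal F$-stable under ultrafilters if $Y_{\mathcal F}(\mathscr U)\subseteq Y$ for every ultrafilter $\mathscr U$ on $Y$. The $\mathcal F$-stable subsets are the closed sets of a topology on $X$, the $\mathcal F$-ultrafilter topology; $X^{\mathcal F\text{-ultra}}$ denotes the set $X$ with this topology. A topological space is called spectral if it is homeomorphic to $\operatorname{Spec}(A)$, with the Zariski topology, for some commutative ring $A$ with identity. Let $X$ be a topological space. Then the following conditions are equivalent. (i) $X$ is a spectral space. (ii) There is a basis $\mathcal B$ of open sets of $X$ such that $X^{\mathcal B\text{-ultra}}$ is compact (every open cover has a finite subcover) and Hausdorff. (iii) $X$ satisfies the $T_0$ axiom and there is a basis $\mathcal B$ of open sets of $X$ such that $X_{\mathcal B}(\mathscr U)\neq\emptyset$ for every ultrafilter $\mathscr U$ on $X$. (iv) $X$ satisfies the $T_0$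 axiom and there is a subbasis $\mathcal S$ of open sets of $X$ such that $X_{\mathcal S}(\mathscr U)\neq\emptyset$ for every ultrafilter $\mathscr U$ on $X$. -/

import Mathlib

universe u v

namespace FUltra

/-- A topological space is spectral if it is homeomorphic to `Spec R`, with the Zariski topology,
for some commutative ring `R` with identity. The auxiliary universe `v` allows the ring to live in
any universe that is at least as large as that of the space. -/
def IsSpectral (X : Type u) [TopologicalSpace X] : Prop :=
  ∃ (R : Type (max u v)) (_ : CommRing R), Nonempty (X ≃ₜ PrimeSpectrum R)

variable {X : Type u}

/-- For a collection `𝓕` of subsets of `X`, a subset `Y` of `X` and an ultrafilter `U` on `Y`, the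
set `Y_𝓕(U)` of the points `x` of `X` such that, for every `F ∈ 𝓕`, `x ∈ F` if and only if
`F ∩ Y ∈ U`. (The trace `F ∩ Y`, as a subset of the type `Y`, is the preimage of `F` under the
inclusion.) -/
def limitSetOn (𝓕 : Set (Set X)) (Y : Set X) (U : Ultrafilter Y) : Set X :=
  {x | ∀ F ∈ 𝓕, x ∈ F ↔ ((↑) ⁻¹' F : Set Y) ∈ U}

/-- The set `X_𝓕(U)` for an ultrafilter `U` on the whole of `X`: the points `x` such that, for
every `F ∈ 𝓕`, `x ∈ F` if and only if `F ∈ U`. -/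
def limitSet (𝓕 : Set (Set X)) (U : Ultrafilter X) : Set X :=
  {x | ∀ F ∈ 𝓕, x ∈ F ↔ F ∈ U}

/-- `Y` is `𝓕`-stable under ultrafilters if `Y_𝓕(U) ⊆ Y` for every ultrafilter `U` on `Y`. -/
def IsStable (𝓕 : Set (Set X)) (Y : Set X) : Prop :=
  ∀ U : Ultrafilter Y, limitSetOn 𝓕 Y U ⊆ Y

theorem limitSetOn_eq (𝓕 : Set (Set X)) (Y : Set X) (U : Ultrafilter Y) :
    limitSetOn 𝓕 Y U = limitSet 𝓕 (U.map (↑)) := rfl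

/-- `limitSet` is the case `Y = X` of `limitSetOn`. -/
theorem limitSetOn_univ (𝓕 : Set (Set X)) (U : Ultrafilter X) :
    limitSetOn 𝓕 Set.univ (U.map (Equiv.Set.univ X).symm) = limitSet 𝓕 U := rfl

theorem isStable_iff (𝓕 : Set (Set X)) (Y : Set X) :
    IsStable 𝓕 Y ↔ ∀ U : Ultrafilter X, Y ∈ U → limitSet 𝓕 U ⊆ Y := by
  constructor
  · intro h U hU
    have hr : Set.range ((↑) : Y → X) ∈ U := by simpa using hU
    have hm : (U.comap Subtype.val_injective hr).map ((↑) : Y → X) = U :=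
      Ultrafilter.coe_injective (Filter.map_comap_of_mem hr)
    have := h (U.comap Subtype.val_injective hr)
    rwa [limitSetOn_eq, hm] at this
  · intro h U
    rw [limitSetOn_eq]
    refine h _ ?_
    rw [Ultrafilter.mem_map, Subtype.coe_preimage_self]
    exact Filter.univ_mem

/-- The `𝓕`-ultrafilter topology on `X`: its closed sets are the subsets of `X` that are
`𝓕`-stable under ultrafilters. -/
abbrev ultraTopology (𝓕 : Set (Set X)) : TopologicalSpace X :=
  TopologicalSpace.ofClosed {Y | IsStable 𝓕 Y}
    (by
      refine (isStable_iff 𝓕 ∅).2 fun U hU => ?_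
      exact (U.empty_notMem hU).elim)
    (by
      intro A hA
      refine (isStable_iff 𝓕 _).2 fun U hU x hx => ?_
      intro Z hZ
      exact (isStable_iff 𝓕 Z).1 (hA hZ) U
        (Filter.mem_of_superset hU (Set.sInter_subset_of_mem hZ)) hx)
    (by
      intro Y hY Z hZ
      refine (isStable_iff 𝓕 _).2 fun U hU x hx => ?_
      rcases Ultrafilter.union_mem_iff.1 hU with h | h
      · exact Or.inl ((isStable_iff 𝓕 Y).1 hY U h hx)
      · exact Or.inr ((isStable_iff 𝓕 Z).1 hZ U h hx))

/-- The set `X` endowed with the `𝓕`-ultrafilter topology. -/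
def UltraSpace (_𝓕 : Set (Set X)) : Type u := X

instance (𝓕 : Set (Set X)) : TopologicalSpace (UltraSpace 𝓕) := ultraTopology 𝓕

theorem isClosed_iff_isStable (𝓕 : Set (Set X)) (Y : Set X) :
    @IsClosed X (ultraTopology 𝓕) Y ↔ IsStable 𝓕 Y := by
  rw [← @isOpen_compl_iff X Y (ultraTopology 𝓕)]
  change IsStable 𝓕 Yᶜᶜ ↔ _
  rw [compl_compl]

end FUltra

/-!
The equivalence of the two middle conditions is formal. The members of `𝓕` are clopen in the
`𝓕`-ultrafilter topology, so an ultrafilter `U` converges there exactly to the points of `X_𝓕(U)`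
(`mem_limitSet_iff`); hence that topology is compact if and only if all the `X_𝓕(U)` are nonempty
(`compactSpace_ultraSpace_iff`), and it is Hausdorff if and only if `𝓕` separates points
(`t2Space_ultraSpace_iff`). For a prime spectrum, the basis of the sets `D(f)` has this property,
since `{f | D(f) ∉ U}` is a prime ideal (`IsSpectral.exists_basis`).

The remaining implication, from a subbasis `𝓢` with all `X_𝓢(U)` nonempty to a ring with spectrum
`X`, is Hochster's theorem. The ring is written down explicitly. Let `K = ℚ(X_s : s ∈ 𝓢)`. For a
point `y` let `k(y) ⊆ K` be generated by the `X_s` with `y ∈ s`, and let `v_y` be the valuation on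
`K` that gives weight `1` to the `X_s` with `y ∉ s` and weight `0` to the others; it is trivial on
`k(y)`. The ring `A` (`spectralRing`) consists of the functions `a : X → K`, locally constant in the
ultrafilter topology, such that `a y ∈ k(y)`, and `a x - a y` has positive order for `v_y` whenever
`x` specializes to `y`. A point `x` is sent to the prime ideal of the functions vanishing at `x`.

* If `a y ≠ 0` and `x` specializes to `y`, then `a x ≠ 0`, because `v_y` is trivial on `k(y)`.
  So the set `{a ≠ 0}` is clopen in the ultrafilter topology and stable under generization, and by
  compactness it is open (`isOpen_of_isOpen_ultraSpace`). As the function `X_s` on `s`, `0` off `s`,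
  belongs to `A`, the map to the spectrum induces the topology of `X` (`isInducing_toSpec`).
* If `a` vanishes wherever `b` does, then `a ^ n / b`, with value `0` at the zeros of `b`, belongs to
  `A` for large `n`: by compactness `b` has finitely many values, whose orders are bounded for all
  `v_y` simultaneously (`exists_pow_lt_weightVal`, `exists_dvd_pow`).
* The common zeros of `a` and `b` are the zeros of `a + n b` for some natural number `n`, again
  because there are only finitely many values (`exists_add_natCast_mul`).

The last two facts show that, for a prime `Q` of `A`, the sets `{a ≠ 0, b = 0}` with `a ∉ Q` and
`b ∈ Q` form a directed family of nonempty closed sets of the compact ultrafilter topology. A point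
in all of them is mapped to `Q` (`toSpec_surjective`).
-/

namespace FUltra

open scoped WithZero Topology

/-! ### The weight valuations on a field of rational functions -/

/-- The field `ℚ(X_s : s ∈ σ)` of rational functions in indeterminates indexed by `σ`. -/
abbrev RatField (σ : Type u) : Type u := FractionRing (MvPolynomial σ ℚ)

/-- The indeterminate `X_s`, as a rational function. -/
noncomputable def indet {σ : Type u} (s : σ) : RatField σ :=
  algebraMap (MvPolynomial σ ℚ) (RatField σ) (MvPolynomial.X s)

theorem indet_ne_zero {σ : Type u} (s : σ) : indet s ≠ 0 := by
  simp [indet, MvPolynomial.X_ne_zero]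

open Classical in
/-- The homomorphism `X_s ↦ X_s t` for `s ∈ T` and `X_s ↦ X_s` for `s ∉ T`, from polynomials in the
`X_s` to polynomials in `t`: it marks the indeterminates in `T` by a power of `t`. -/
noncomputable def weightPolyHom {σ : Type u} (T : Set σ) :
    MvPolynomial σ ℚ →+* Polynomial (RatField σ) :=
  MvPolynomial.eval₂Hom (algebraMap ℚ _)
    fun s => if s ∈ T then Polynomial.C (indet s) * Polynomial.X else Polynomial.C (indet s)

theorem weightPolyHom_injective {σ : Type u} (T : Set σ) :
    Function.Injective (weightPolyHom T) := by
  -- Setting `t = 1` recovers the original polynomial.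
  have h : (Polynomial.evalRingHom 1).comp (weightPolyHom T) =
      algebraMap (MvPolynomial σ ℚ) (RatField σ) := by
    refine MvPolynomial.ringHom_ext (fun r => ?_) fun s => ?_
    · exact DFunLike.congr_fun (Subsingleton.elim
        (((Polynomial.evalRingHom 1).comp (weightPolyHom T)).comp MvPolynomial.C)
        ((algebraMap (MvPolynomial σ ℚ) (RatField σ)).comp MvPolynomial.C)) r
    · by_cases hs : s ∈ T <;> simp [weightPolyHom, hs, indet]
  refine Function.Injective.of_comp (f := Polynomial.evalRingHom 1) ?_
  rw [← RingHom.coe_comp, h]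
  exact IsFractionRing.injective _ _

theorem algebraMap_comp_weightPolyHom_injective {σ : Type u} (T : Set σ) :
    Function.Injective
      ((algebraMap (Polynomial (RatField σ)) (RatFunc (RatField σ))).comp (weightPolyHom T)) := by
  rw [RingHom.coe_comp]
  exact (IsFractionRing.injective _ _).comp (weightPolyHom_injective T)

/-- The extension of `weightPolyHom` to rational functions. -/
noncomputable def weightHom {σ : Type u} (T : Set σ) :
    RatField σ →+* RatFunc (RatField σ) :=
  IsFractionRing.lift (algebraMap_comp_weightPolyHom_injective T)

theorem weightHom_algebraMap {σ : Type u} (T : Set σ) (f : MvPolynomial σ ℚ) :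
    weightHom T (algebraMap _ _ f) = algebraMap _ _ (weightPolyHom T f) :=
  IsFractionRing.lift_algebraMap (algebraMap_comp_weightPolyHom_injective T) f

/-- The valuation on rational functions for which the indeterminates `X_s` with `s ∈ T` have
weight `1`, and the others weight `0`: the order at `t = 0` after substituting `X_s t` for `X_s`,
`s ∈ T`. It is written multiplicatively, so positive order means value less than `1`. -/
noncomputable def weightVal {σ : Type u} (T : Set σ) : Valuation (RatField σ) ℤᵐ⁰ :=
  ((Polynomial.idealX (RatField σ)).valuation (RatFunc (RatField σ))).comap (weightHom T)

theorem weightVal_indet_lt_one {σ : Type u} {T : Set σ} {s : σ} (hs : s ∈ T) :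
    weightVal T (indet s) < 1 := by
  rw [weightVal, Valuation.comap_apply, indet, weightHom_algebraMap]
  refine (IsDedekindDomain.HeightOneSpectrum.valuation_lt_one_iff_mem _ _).2 ?_
  simp [weightPolyHom, hs, Polynomial.idealX_span, Ideal.mem_span_singleton]

/-- The valuation `weightVal T` is trivial on the rational functions that involve only
indeterminates of weight `0`. -/
theorem weightVal_eq_one {σ : Type u} {T : Set σ} {z : RatField σ}
    (hz : z ∈ Subfield.closure (indet '' Tᶜ)) (h0 : z ≠ 0) : weightVal T z = 1 := by
  have hle : ∀ c : RatField σ, (Polynomial.idealX (RatField σ)).valuation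
      (RatFunc (RatField σ)) (algebraMap _ _ (Polynomial.C c)) ≤ 1 := fun c =>
    IsDedekindDomain.HeightOneSpectrum.valuation_le_one _ _
  have heq : Set.EqOn (weightHom T) ((algebraMap (Polynomial (RatField σ))
      (RatFunc (RatField σ))).comp Polynomial.C) (Subfield.closure (indet '' Tᶜ)) := by
    refine RingHom.eqOn_field_closure ?_
    rintro _ ⟨s, hs, rfl⟩
    rw [indet, weightHom_algebraMap]
    have hs' : s ∉ T := hs
    simp [weightPolyHom, hs', indet]
  rw [weightVal, Valuation.comap_apply, heq hz]
  refine le_antisymm (hle z) ?_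
  have h1 := hle z⁻¹
  -- `z` and `z⁻¹` are both constants of `K[t]`, so both have value at most `1`.
  have hmul : (Polynomial.idealX (RatField σ)).valuation (RatFunc (RatField σ))
      (algebraMap _ _ (Polynomial.C z)) * (Polynomial.idealX (RatField σ)).valuation
      (RatFunc (RatField σ)) (algebraMap _ _ (Polynomial.C z⁻¹)) = 1 := by
    rw [← map_mul, ← map_mul, ← map_mul, mul_inv_cancel₀ h0, map_one, map_one, map_one]
  exact hmul.symm.le.trans (mul_le_of_le_one_right' h1)

theorem weightVal_le_one {σ : Type u} {T : Set σ} {z : RatField σ}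
    (hz : z ∈ Subfield.closure (indet '' Tᶜ)) : weightVal T z ≤ 1 := by
  rcases eq_or_ne z 0 with rfl | h0
  · simp
  · exact (weightVal_eq_one hz h0).le

/-- A polynomial involves only finitely many indeterminates, so it has only finitely many images
under the homomorphisms `weightPolyHom T`. -/
theorem finite_range_weightPolyHom {σ : Type u} (f : MvPolynomial σ ℚ) :
    (Set.range fun T : Set σ => weightPolyHom T f).Finite := by
  induction f using MvPolynomial.induction_on with
  | C r =>
    refine (Set.finite_singleton (algebraMap ℚ (Polynomial (RatField σ)) r)).subset ?_
    rintro _ ⟨T, rfl⟩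
    simp [weightPolyHom]
  | add p q hp hq =>
    refine (hp.image2 (· + ·) hq).subset ?_
    rintro _ ⟨T, rfl⟩
    exact ⟨_, ⟨T, rfl⟩, _, ⟨T, rfl⟩, (map_add _ _ _).symm⟩
  | mul_X p s hp =>
    refine (hp.image2 (· * ·) (Set.toFinite
      {Polynomial.C (indet s) * Polynomial.X, Polynomial.C (indet s)})).subset ?_
    rintro _ ⟨T, rfl⟩
    refine ⟨_, ⟨T, rfl⟩, weightPolyHom T (MvPolynomial.X s), ?_, (map_mul _ _ _).symm⟩
    by_cases hs : s ∈ T <;> simp [weightPolyHom, hs]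

theorem finite_range_weightVal {σ : Type u} (z : RatField σ) :
    (Set.range fun T : Set σ => weightVal T z).Finite := by
  obtain ⟨f, g, -, rfl⟩ := IsFractionRing.div_surjective (A := MvPolynomial σ ℚ) z
  refine ((finite_range_weightPolyHom f).image2 (fun p q =>
    (Polynomial.idealX (RatField σ)).valuation (RatFunc (RatField σ))
      (algebraMap _ _ p / algebraMap _ _ q)) (finite_range_weightPolyHom g)).subset ?_
  rintro _ ⟨T, rfl⟩
  refine ⟨_, ⟨T, rfl⟩, _, ⟨T, rfl⟩, ?_⟩
  simp only [weightVal, Valuation.comap_apply]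
  rw [map_div₀ (weightHom T), weightHom_algebraMap, weightHom_algebraMap]

/-- For finitely many rational functions and all the valuations `weightVal T` at once, a fixed power
of an element of positive order has larger order than any nonzero member of the finite set. -/
theorem exists_pow_lt_weightVal {σ : Type u} {F : Set (RatField σ)} (hF : F.Finite) :
    ∃ n : ℕ, n ≠ 0 ∧ ∀ (T : Set σ) (w z : RatField σ), weightVal T w < 1 → z ∈ F → z ≠ 0 →
      weightVal T w ^ n < weightVal T z := by
  have hfin : (⋃ z ∈ F, Set.range fun T : Set σ => weightVal T z).Finite :=
    hF.biUnion fun z _ => finite_range_weightVal z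
  -- The valuation is discrete, so positive order means value at most `exp (-1)`; it suffices to
  -- find a power of `exp (-1)` below the finitely many nonzero values.
  have hex : ∀ γ : ℤᵐ⁰, ∃ n : ℕ, γ ≠ 0 → (WithZero.exp (-1 : ℤ) : ℤᵐ⁰) ^ n < γ := by
    intro γ
    by_cases h : γ = 0
    · exact ⟨0, fun h' => (h' h).elim⟩
    · have h1 : (WithZero.exp (-1 : ℤ) : ℤᵐ⁰) < 1 := by
        rw [← WithZero.exp_zero]; exact WithZero.exp_lt_exp.2 (by norm_num)
      obtain ⟨n, hn⟩ := exists_pow_lt₀ h1 (Units.mk0 γ h)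
      exact ⟨n, fun _ => hn⟩
  choose N hN using hex
  obtain ⟨M, hM⟩ := (hfin.image N).bddAbove
  refine ⟨M + 1, M.succ_ne_zero, fun T w z hw hz h0 => ?_⟩
  have hv : weightVal T z ≠ 0 := (Valuation.ne_zero_iff _).2 h0
  have hle : N (weightVal T z) ≤ M + 1 :=
    (hM ⟨_, Set.mem_biUnion hz ⟨T, rfl⟩, rfl⟩).trans M.le_succ
  have hw1 : weightVal T w ≤ WithZero.exp (-1 : ℤ) := by
    rw [← WithZero.lt_mul_exp_iff_le WithZero.exp_ne_zero, ← WithZero.exp_add]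
    simpa using hw
  calc weightVal T w ^ (M + 1) ≤ weightVal T w ^ N (weightVal T z) :=
        pow_le_pow_right_of_le_one' hw.le hle
    _ ≤ (WithZero.exp (-1 : ℤ) : ℤᵐ⁰) ^ N (weightVal T z) := by gcongr
    _ < weightVal T z := hN _ hv

/-! ### The ultrafilter topology -/

section UltraTopology

variable {X : Type u} {𝓕 : Set (Set X)}

/-- The members of `𝓕` are clopen in the `𝓕`-ultrafilter topology. -/
theorem isClopen_of_mem {F : Set X} (hF : F ∈ 𝓕) :
    IsClopen (X := UltraSpace 𝓕) F := by
  refine ⟨(isClosed_iff_isStable 𝓕 F).2 ((isStable_iff 𝓕 F).2 fun U hU x hx => (hx F hF).2 hU), ?_⟩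
  have hc : IsStable 𝓕 Fᶜ := (isStable_iff 𝓕 Fᶜ).2 fun U hU x hx hxF =>
    Ultrafilter.compl_mem_iff_notMem.1 hU ((hx F hF).1 hxF)
  exact (isClosed_compl_iff (X := UltraSpace 𝓕)).1 ((isClosed_iff_isStable 𝓕 Fᶜ).2 hc)

theorem mem_of_isClosed {Z : Set X} (hZ : IsClosed (X := UltraSpace 𝓕) Z) {U : Ultrafilter X}
    (hU : Z ∈ U) {x : X} (hx : x ∈ limitSet 𝓕 U) : x ∈ Z :=
  (isStable_iff 𝓕 Z).1 ((isClosed_iff_isStable 𝓕 Z).1 hZ) U hU hx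

/-- In the `𝓕`-ultrafilter topology, an ultrafilter `U` converges exactly to the points of the set
`X_𝓕(U)`. -/
theorem mem_limitSet_iff {U : Ultrafilter X} {x : X} :
    x ∈ limitSet 𝓕 U ↔ (U : Filter X) ≤ @nhds (UltraSpace 𝓕) _ x := by
  constructor
  · intro hx
    refine (le_nhds_iff (X := UltraSpace 𝓕)).2 fun s hxs hs => ?_
    by_contra hsU
    exact mem_of_isClosed hs.isClosed_compl (Ultrafilter.compl_mem_iff_notMem.2 hsU) hx hxs
  · intro h F hF
    have hc := isClopen_of_mem hF
    refine ⟨fun hx => h (hc.isOpen.mem_nhds hx), fun hU => by_contra fun hx => ?_⟩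
    exact Ultrafilter.compl_mem_iff_notMem.1 (h (hc.compl.isOpen.mem_nhds hx)) hU

theorem compactSpace_ultraSpace_iff :
    CompactSpace (UltraSpace 𝓕) ↔ ∀ U : Ultrafilter X, (limitSet 𝓕 U).Nonempty := by
  rw [← isCompact_univ_iff, isCompact_iff_ultrafilter_le_nhds]
  simp only [Filter.principal_univ, le_top, Set.mem_univ, true_and, forall_const]
  exact forall_congr' fun U => exists_congr fun x => mem_limitSet_iff.symm

theorem specializes_iff_of_generateFrom [t : TopologicalSpace X]
    (ht : t = TopologicalSpace.generateFrom 𝓕) {x y : X} :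
    x ⤳ y ↔ ∀ F ∈ 𝓕, y ∈ F → x ∈ F := by
  have hopen : ∀ F ∈ 𝓕, IsOpen F := fun F hF =>
    ht ▸ TopologicalSpace.isOpen_generateFrom_of_mem hF
  refine ⟨fun h F hF hy => h.mem_open (hopen F hF) hy, fun h => ?_⟩
  have hy : 𝓝 y = ⨅ F ∈ {F | y ∈ F ∧ F ∈ 𝓕}, Filter.principal F := by
    rw [ht]; exact TopologicalSpace.nhds_generateFrom
  rw [Specializes, hy]
  exact le_iInf₂ fun F hF =>
    Filter.le_principal_iff.2 ((hopen F hF.2).mem_nhds (h F hF.2 hF.1))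

theorem inseparable_iff_of_generateFrom [t : TopologicalSpace X]
    (ht : t = TopologicalSpace.generateFrom 𝓕) {x y : X} :
    Inseparable x y ↔ ∀ F ∈ 𝓕, x ∈ F ↔ y ∈ F := by
  rw [inseparable_iff_specializes_and, specializes_iff_of_generateFrom ht,
    specializes_iff_of_generateFrom ht]
  exact ⟨fun h F hF => ⟨h.2 F hF, h.1 F hF⟩, fun h => ⟨fun F hF => (h F hF).2,
    fun F hF => (h F hF).1⟩⟩

theorem t2Space_ultraSpace_iff [t : TopologicalSpace X]
    (ht : t = TopologicalSpace.generateFrom 𝓕) :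
    T2Space (UltraSpace 𝓕) ↔ T0Space X := by
  constructor
  · refine fun _ => ⟨fun x y hxy => ?_⟩
    -- The principal ultrafilter at `x` converges to `x` and to `y`.
    have hx : x ∈ limitSet 𝓕 (pure x) := fun F _ => by simp
    have hy : y ∈ limitSet 𝓕 (pure x) := fun F hF => by
      simpa using ((inseparable_iff_of_generateFrom ht).1 hxy F hF).symm
    exact t2_iff_ultrafilter.1 ‹T2Space (UltraSpace 𝓕)› (pure x) (mem_limitSet_iff.1 hx)
      (mem_limitSet_iff.1 hy)
  · refine fun _ => ⟨fun (x : X) (y : X) hne => ?_⟩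
    have hn : ¬ Inseparable x y := fun h => hne h.eq
    rw [inseparable_iff_of_generateFrom ht] at hn
    push Not at hn
    obtain ⟨F, hF, ⟨hx, hy⟩ | ⟨hx, hy⟩⟩ := hn
    · exact ⟨F, Fᶜ, (isClopen_of_mem hF).isOpen, (isClopen_of_mem hF).compl.isOpen, hx, hy,
        disjoint_compl_right⟩
    · exact ⟨Fᶜ, F, (isClopen_of_mem hF).compl.isOpen, (isClopen_of_mem hF).isOpen, hx, hy,
        disjoint_compl_left⟩

/-- An ultra-open set that contains, with a point, all points specializing to it is open in the
topology generated by `𝓕`, provided that the ultrafilter topology is compact. -/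
theorem isOpen_of_isOpen_ultraSpace [t : TopologicalSpace X]
    (ht : t = TopologicalSpace.generateFrom 𝓕) (hU : ∀ U : Ultrafilter X, (limitSet 𝓕 U).Nonempty)
    {V : Set X} (hV : IsOpen (X := UltraSpace 𝓕) V)
    (hgen : ∀ x y : X, x ⤳ y → y ∈ V → x ∈ V) : IsOpen V := by
  refine isOpen_iff_ultrafilter.2 fun y hy U hUy => by_contra fun hVU => ?_
  -- A limit point `x ∉ V` of `U` in the ultrafilter topology specializes to the limit `y ∈ V`.
  obtain ⟨x, hx⟩ := hU U
  refine mem_of_isClosed hV.isClosed_compl (Ultrafilter.compl_mem_iff_notMem.2 hVU) hx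
    (hgen x y ((specializes_iff_of_generateFrom ht).2 fun F hF hyF => (hx F hF).2 (hUy ?_)) hy)
  exact IsOpen.mem_nhds (ht ▸ TopologicalSpace.isOpen_generateFrom_of_mem hF) hyF

end UltraTopology

/-- The traces of the basic open subsets of a prime spectrum: every ultrafilter has a limit point,
namely the prime ideal of the elements whose non-vanishing locus is not in the ultrafilter. -/
theorem IsSpectral.exists_basis {X : Type u} [TopologicalSpace X] (h : IsSpectral.{u, v} X) :
    T0Space X ∧ ∃ 𝓑 : Set (Set X), TopologicalSpace.IsTopologicalBasis 𝓑 ∧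
      ∀ U : Ultrafilter X, (limitSet 𝓑 U).Nonempty := by
  obtain ⟨R, _, ⟨e⟩⟩ := h
  refine ⟨e.isEmbedding.t0Space, _,
    PrimeSpectrum.isTopologicalBasis_basic_opens.isInducing e.isInducing, fun U => ?_⟩
  have hV : ∀ {f : R}, {x | f ∈ (e x).asIdeal} ∈ U ↔ {x | f ∉ (e x).asIdeal} ∉ U := by
    intro f
    rw [← Ultrafilter.compl_mem_iff_notMem]
    simp [Set.compl_ofPred]
  let P : Ideal R :=
    { carrier := {f | {x | f ∈ (e x).asIdeal} ∈ U}
      add_mem' := fun ha hb => Filter.mem_of_superset (Filter.inter_mem ha hb)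
        fun x hx => Ideal.add_mem _ hx.1 hx.2
      zero_mem' := Filter.mem_of_superset Filter.univ_mem fun x _ => Ideal.zero_mem _
      smul_mem' := fun c a ha => Filter.mem_of_superset ha fun x hx => Ideal.mul_mem_left _ c hx }
  have hP : P.IsPrime := by
    refine ⟨fun htop => ?_, fun {a b} hab => ?_⟩
    · have h1 : {x | (1 : R) ∈ (e x).asIdeal} ∈ U := (Ideal.eq_top_iff_one P).1 htop
      refine U.empty_notMem (Filter.mem_of_superset h1 fun x hx => ?_)
      exact (e x).2.one_notMem hx
    · refine Ultrafilter.union_mem_iff.1 (Filter.mem_of_superset hab fun x hx => ?_)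
      exact (e x).2.mem_or_mem hx
  refine ⟨e.symm ⟨P, hP⟩, ?_⟩
  rintro _ ⟨_, ⟨f, rfl⟩, rfl⟩
  have h1 : e.symm ⟨P, hP⟩ ∈ e ⁻¹' (PrimeSpectrum.basicOpen f : Set (PrimeSpectrum R)) ↔
      {x | f ∈ (e x).asIdeal} ∉ U := by simp [P]
  rw [h1, hV, not_not]
  rfl

/-! ### A ring with prescribed spectrum -/

section SpectralRing

variable {X : Type u} {𝓢 : Set (Set X)}

/-- The indeterminates given weight `1` at the point `y`: those `X_s` with `y ∉ s`. -/
def vanishingAt (𝓢 : Set (Set X)) (y : X) : Set 𝓢 := {s | y ∉ s.1}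

/-- The subfield `k(y)` generated by the indeterminates `X_s` with `y ∈ s`. -/
noncomputable def residueSubfield (𝓢 : Set (Set X)) (y : X) : Subfield (RatField 𝓢) :=
  Subfield.closure (indet '' (vanishingAt 𝓢 y)ᶜ)

/-- A function `a : X → ℚ(X_s : s ∈ 𝓢)` is coherent if `a y` lies in the subfield `k(y)` for every
`y`, and if `a x` reduces to `a y` modulo positive weight at `y` whenever every `s ∈ 𝓢` that
contains `y` contains `x`, that is, whenever `x` specializes to `y` in the topology
generated by `𝓢`. -/
def IsCoherent (a : X → RatField 𝓢) : Prop :=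
  ∀ y, a y ∈ residueSubfield 𝓢 y ∧
    ∀ x, (∀ s ∈ 𝓢, y ∈ s → x ∈ s) → weightVal (vanishingAt 𝓢 y) (a x - a y) < 1

namespace IsCoherent

variable {a b : X → RatField 𝓢}

theorem weightVal_le_one (ha : IsCoherent a) {x y : X} (h : ∀ s ∈ 𝓢, y ∈ s → x ∈ s) :
    weightVal (vanishingAt 𝓢 y) (a x) ≤ 1 := by
  rw [← sub_add_cancel (a x) (a y)]
  exact Valuation.map_add_le _ ((ha y).2 x h).le (FUltra.weightVal_le_one (ha y).1)

theorem ne_zero (ha : IsCoherent a) {x y : X} (h : ∀ s ∈ 𝓢, y ∈ s → x ∈ s) (hy : a y ≠ 0) :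
    a x ≠ 0 := by
  intro hx
  have h1 := (ha y).2 x h
  rw [hx, zero_sub, Valuation.map_neg, weightVal_eq_one (ha y).1 hy] at h1
  exact lt_irrefl _ h1

theorem weightVal_eq_one_of_ne_zero (ha : IsCoherent a) {x y : X} (h : ∀ s ∈ 𝓢, y ∈ s → x ∈ s)
    (hy : a y ≠ 0) : weightVal (vanishingAt 𝓢 y) (a x) = 1 := by
  have h1 := weightVal_eq_one (ha y).1 hy
  rw [← h1]
  exact Valuation.map_eq_of_sub_lt _ (h1.symm ▸ (ha y).2 x h)

theorem one : IsCoherent (1 : X → RatField 𝓢) := fun _ => ⟨one_mem _, fun _ _ => by simp⟩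

theorem add (ha : IsCoherent a) (hb : IsCoherent b) : IsCoherent (a + b) := fun y =>
  ⟨add_mem (ha y).1 (hb y).1, fun x h => by
    rw [Pi.add_apply, Pi.add_apply, add_sub_add_comm]
    exact Valuation.map_add_lt _ ((ha y).2 x h) ((hb y).2 x h)⟩

theorem neg (ha : IsCoherent a) : IsCoherent (-a) := fun y =>
  ⟨neg_mem (ha y).1, fun x h => by
    rw [Pi.neg_apply, Pi.neg_apply, neg_sub_neg, Valuation.map_sub_swap]
    exact (ha y).2 x h⟩

theorem mul (ha : IsCoherent a) (hb : IsCoherent b) : IsCoherent (a * b) := fun y =>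
  ⟨mul_mem (ha y).1 (hb y).1, fun x h => by
    have : (a * b) x - (a * b) y = a x * (b x - b y) + b y * (a x - a y) := by
      simp only [Pi.mul_apply]; ring
    rw [this]
    refine Valuation.map_add_lt _ ?_ ?_ <;> rw [map_mul]
    · exact mul_lt_one_of_nonneg_of_lt_one_right (ha.weightVal_le_one h) zero_le ((hb y).2 x h)
    · exact mul_lt_one_of_nonneg_of_lt_one_right (FUltra.weightVal_le_one (hb y).1) zero_le
        ((ha y).2 x h)⟩

theorem pow (ha : IsCoherent a) (n : ℕ) : IsCoherent (a ^ n) := by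
  induction n with
  | zero => rw [pow_zero]; exact one
  | succ n ih => rw [pow_succ]; exact ih.mul ha

/-- Coherence of a quotient, with value `0` where the denominator vanishes: it only has to be
checked at specializations to a point where the denominator becomes zero. -/
theorem div (ha : IsCoherent a) (hb : IsCoherent b)
    (hlt : ∀ x y : X, (∀ s ∈ 𝓢, y ∈ s → x ∈ s) → b y = 0 → b x ≠ 0 →
      weightVal (vanishingAt 𝓢 y) (a x) < weightVal (vanishingAt 𝓢 y) (b x)) :
    IsCoherent (a / b) := fun y =>
  ⟨div_mem (ha y).1 (hb y).1, fun x h => by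
    rw [Pi.div_apply, Pi.div_apply]
    by_cases hy : b y = 0
    · rw [hy, div_zero, sub_zero]
      by_cases hx : b x = 0
      · simp [hx]
      · rw [map_div₀]
        exact (div_lt_one₀ (zero_lt_iff.2 ((Valuation.ne_zero_iff _).2 hx))).2 (hlt x y h hy hx)
    · have hx := hb.ne_zero h hy
      have : a x / b x - a y / b y =
          ((a x - a y) * b y - a y * (b x - b y)) / (b x * b y) := by
        field_simp; ring
      rw [this, map_div₀, map_mul, hb.weightVal_eq_one_of_ne_zero h hy,
        weightVal_eq_one (hb y).1 hy, one_mul, div_one]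
      refine (Valuation.map_sub _ _ _).trans_lt (max_lt ?_ ?_) <;> rw [map_mul]
      · exact mul_lt_one_of_nonneg_of_lt_one_left zero_le ((ha y).2 x h)
          (FUltra.weightVal_le_one (hb y).1)
      · exact mul_lt_one_of_nonneg_of_lt_one_right (FUltra.weightVal_le_one (ha y).1) zero_le
          ((hb y).2 x h)⟩

end IsCoherent

/-- The ring of coherent functions on `X` that are locally constant in the ultrafilter topology of
`𝓢`. Its spectrum turns out to be `X` with the topology generated by `𝓢`. -/
noncomputable def spectralRing (𝓢 : Set (Set X)) :
    Subring (LocallyConstant (UltraSpace 𝓢) (RatField 𝓢)) where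
  carrier := {a | IsCoherent (X := X) a}
  mul_mem' ha hb := IsCoherent.mul ha hb
  one_mem' := IsCoherent.one
  add_mem' ha hb := IsCoherent.add ha hb
  zero_mem' := fun _ => ⟨zero_mem _, fun _ _ => by
    change weightVal _ (0 - 0) < 1
    simp⟩
  neg_mem' ha := IsCoherent.neg ha

/-- Evaluation at a point `x` of `X`. -/
noncomputable def evalAt (x : X) : spectralRing 𝓢 →+* RatField 𝓢 :=
  (LocallyConstant.evalRingHom (X := UltraSpace 𝓢) x).comp (spectralRing 𝓢).subtype

theorem isCoherent_evalAt (a : spectralRing 𝓢) : IsCoherent fun x => evalAt x a := a.2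

theorem isLocallyConstant_evalAt (a : spectralRing 𝓢) :
    IsLocallyConstant (X := UltraSpace 𝓢) fun x => evalAt x a := a.1.isLocallyConstant

theorem exists_evalAt_eq {f : X → RatField 𝓢} (hf : IsCoherent f)
    (hc : IsLocallyConstant (X := UltraSpace 𝓢) f) :
    ∃ a : spectralRing 𝓢, ∀ x, evalAt x a = f x :=
  ⟨⟨⟨f, hc⟩, hf⟩, fun _ => rfl⟩

theorem spectralRing_ext {a b : spectralRing 𝓢} (h : ∀ x : X, evalAt x a = evalAt x b) : a = b :=
  Subtype.ext (LocallyConstant.ext h)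

open Classical in
/-- The function equal to the indeterminate `X_s` on `s` and to `0` elsewhere is a member of the
ring. -/
theorem exists_evalAt_ne_zero_iff_mem {s : Set X} (hs : s ∈ 𝓢) :
    ∃ a : spectralRing 𝓢, ∀ x, evalAt x a ≠ 0 ↔ x ∈ s := by
  let f : X → RatField 𝓢 := fun x => if x ∈ s then indet ⟨s, hs⟩ else 0
  have hcoh : IsCoherent f := by
    refine fun y => ⟨?_, fun x h => ?_⟩
    · by_cases hy : y ∈ s
      · simp only [f, hy, if_true]
        exact Subfield.subset_closure ⟨_, by simpa [vanishingAt] using hy, rfl⟩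
      · simp [f, hy]
    · by_cases hy : y ∈ s
      · simp [f, hy, h s hs hy]
      · by_cases hx : x ∈ s
        · simpa [f, hx, hy] using
            weightVal_indet_lt_one (T := vanishingAt 𝓢 y) (s := ⟨s, hs⟩) hy
        · simp [f, hx, hy]
  have hloc : IsLocallyConstant (X := UltraSpace 𝓢) f := by
    have hc := isClopen_of_mem hs
    refine (IsLocallyConstant.iff_eventually_eq _).2 fun x => ?_
    by_cases hx : x ∈ s
    · filter_upwards [hc.isOpen.mem_nhds hx] with z hz
      exact (if_pos hz).trans (if_pos hx).symm
    · filter_upwards [hc.compl.isOpen.mem_nhds hx] with z hz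
      exact (if_neg hz).trans (if_neg hx).symm
  obtain ⟨a, ha⟩ := exists_evalAt_eq hcoh hloc
  refine ⟨a, fun x => ?_⟩
  by_cases hx : x ∈ s <;> simp [ha, f, hx, indet_ne_zero]

/-- If `a` vanishes wherever `b` does, then some power of `a` is a multiple of `b`: by compactness
`b` has finitely many values, so for `n` large the quotient `a ^ n / b` is coherent. -/
theorem exists_dvd_pow [CompactSpace (UltraSpace 𝓢)] {a b : spectralRing 𝓢}
    (h : ∀ x : X, evalAt x b = 0 → evalAt x a = 0) : ∃ n : ℕ, b ∣ a ^ n := by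
  obtain ⟨n, hn0, hn⟩ := exists_pow_lt_weightVal (isLocallyConstant_evalAt b).range_finite
  have hcoh := ((isCoherent_evalAt a).pow n).div (isCoherent_evalAt b) (by
    intro x y hxy hy hx
    have h1 : weightVal (vanishingAt 𝓢 y) (evalAt x a - evalAt y a) < 1 :=
      (isCoherent_evalAt a y).2 x hxy
    rw [h y hy, sub_zero] at h1
    rw [Pi.pow_apply, map_pow]
    exact hn _ _ _ h1 ⟨x, rfl⟩ hx)
  obtain ⟨c, hc⟩ := exists_evalAt_eq hcoh
    ((isLocallyConstant_evalAt a).comp₂ (isLocallyConstant_evalAt b) fun p q => p ^ n / q)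
  refine ⟨n, c, spectralRing_ext fun x => ?_⟩
  rw [map_pow, map_mul, hc]
  by_cases hx : evalAt x b = 0
  · simp [hx, h x hx, hn0]
  · simp [mul_div_cancel₀ _ hx]

/-- Any ideal containing `a` and `b` contains an element whose zeros are the common zeros of `a`
and `b`. -/
theorem exists_add_natCast_mul [CompactSpace (UltraSpace 𝓢)] (a b : spectralRing 𝓢) :
    ∃ n : ℕ, ∀ x : X, evalAt x (a + (n : spectralRing 𝓢) * b) = 0 →
      evalAt x a = 0 ∧ evalAt x b = 0 := by
  -- Only the finitely many values of `-a / b` have to be avoided by `n`.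
  have hfin : (Set.range fun x : X => -evalAt x a / evalAt x b).Finite :=
    ((isLocallyConstant_evalAt a).comp₂ (isLocallyConstant_evalAt b)
      fun p q => -p / q).range_finite
  obtain ⟨n, hn⟩ := (hfin.preimage (Nat.cast_injective (R := RatField 𝓢)).injOn).exists_notMem
  refine ⟨n, fun x hx => ?_⟩
  rw [map_add, map_mul, map_natCast] at hx
  by_cases hb : evalAt x b = 0
  · simpa [hb] using hx
  · refine (hn ⟨x, ?_⟩).elim
    rw [div_eq_iff hb]
    linear_combination -hx

/-- The prime ideal of the functions that vanish at `x`. -/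
noncomputable def toSpec (𝓢 : Set (Set X)) (x : X) : PrimeSpectrum (spectralRing 𝓢) :=
  ⟨RingHom.ker (evalAt x), RingHom.ker_isPrime _⟩

theorem mem_toSpec {x : X} {a : spectralRing 𝓢} :
    a ∈ (toSpec 𝓢 x).asIdeal ↔ evalAt x a = 0 := RingHom.mem_ker

theorem isClopen_evalAt_eq_zero (a : spectralRing 𝓢) :
    IsClopen (X := UltraSpace 𝓢) {x | evalAt x a = 0} :=
  (isLocallyConstant_evalAt a).isClopen_fiber 0

theorem toSpec_surjective [CompactSpace (UltraSpace 𝓢)] :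
    Function.Surjective (toSpec 𝓢) := by
  intro Q
  have hQ := Q.2
  -- A point of the intersection of the sets `Z p` is mapped to `Q`.
  let ι := {p : spectralRing 𝓢 × spectralRing 𝓢 // p.1 ∉ Q.asIdeal ∧ p.2 ∈ Q.asIdeal}
  let Z : ι → Set (UltraSpace 𝓢) := fun p =>
    {x | evalAt x p.1.1 = 0}ᶜ ∩ {x | evalAt x p.1.2 = 0}
  have hZ : ∀ p, IsClosed (Z p) := fun p =>
    (isClopen_evalAt_eq_zero _).compl.isClosed.inter (isClopen_evalAt_eq_zero _).isClosed
  have : Nonempty ι := ⟨⟨(1, 0), hQ.one_notMem, Q.asIdeal.zero_mem⟩⟩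
  obtain ⟨x, hx⟩ : (⋂ p, Z p).Nonempty := by
    refine IsCompact.nonempty_iInter_of_directed_nonempty_isCompact_isClosed Z ?_ ?_
      (fun p => (hZ p).isCompact) hZ
    · rintro ⟨⟨a, b⟩, ha, hb⟩ ⟨⟨a', b'⟩, ha', hb'⟩
      obtain ⟨n, hn⟩ := exists_add_natCast_mul b b'
      refine ⟨⟨(a * a', b + n * b'), fun h => (hQ.mem_or_mem h).elim ha ha',
        Q.asIdeal.add_mem hb (Q.asIdeal.mul_mem_left _ hb')⟩, ?_, ?_⟩
      · rintro x ⟨hx, hx'⟩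
        exact ⟨fun h => hx ((map_mul (evalAt (X := X) x) a a').trans (mul_eq_zero_of_left h _)),
          (hn x hx').1⟩
      · rintro x ⟨hx, hx'⟩
        exact ⟨fun h => hx ((map_mul (evalAt (X := X) x) a a').trans (mul_eq_zero_of_right _ h)),
          (hn x hx').2⟩
    · rintro ⟨⟨a, b⟩, ha, hb⟩
      by_contra hne
      obtain ⟨n, hn⟩ := exists_dvd_pow (a := a) (b := b) fun x hxb =>
        by_contra fun hxa => hne ⟨x, hxa, hxb⟩
      exact ha (hQ.mem_of_pow_mem n (Q.asIdeal.mem_of_dvd hn hb))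
  rw [Set.mem_iInter] at hx
  refine ⟨x, PrimeSpectrum.ext (Ideal.ext fun a => mem_toSpec.trans ⟨fun h => ?_, fun h => ?_⟩)⟩
  · exact by_contra fun ha => (hx ⟨(a, 0), ha, Q.asIdeal.zero_mem⟩).1 h
  · exact (hx ⟨(1, a), hQ.one_notMem, h⟩).2

theorem isInducing_toSpec [t : TopologicalSpace X] (ht : t = TopologicalSpace.generateFrom 𝓢)
    (hU : ∀ U : Ultrafilter X, (limitSet 𝓢 U).Nonempty) :
    Topology.IsInducing (toSpec 𝓢) := by
  refine ⟨le_antisymm ?_ ?_⟩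
  · rw [← continuous_iff_le_induced]
    refine PrimeSpectrum.isTopologicalBasis_basic_opens.continuous_iff.2 ?_
    rintro _ ⟨a, rfl⟩
    refine isOpen_of_isOpen_ultraSpace ht hU (isClopen_evalAt_eq_zero a).compl.isOpen ?_
    exact fun x y hxy hy =>
      (isCoherent_evalAt a).ne_zero ((specializes_iff_of_generateFrom ht).1 hxy) hy
  · conv_rhs => rw [ht]
    refine le_generateFrom fun s hs => ?_
    obtain ⟨a, ha⟩ := exists_evalAt_ne_zero_iff_mem hs
    exact ⟨_, (PrimeSpectrum.basicOpen a).isOpen, Set.ext ha⟩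

/-- Hochster's theorem, in terms of ultrafilters: the ring `spectralRing 𝓢` has spectrum `X`. -/
theorem isSpectral_of_generateFrom [t : TopologicalSpace X] [T0Space X]
    (ht : t = TopologicalSpace.generateFrom 𝓢)
    (hU : ∀ U : Ultrafilter X, (limitSet 𝓢 U).Nonempty) : IsSpectral.{u, v} X := by
  have := compactSpace_ultraSpace_iff.2 hU
  have hind := isInducing_toSpec ht hU
  let e : X ≃ₜ PrimeSpectrum (spectralRing 𝓢) :=
    (Equiv.ofBijective _ ⟨hind.injective, toSpec_surjective⟩).toHomeomorphOfIsInducing hind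
  exact ⟨ULift.{max u v} (spectralRing 𝓢), inferInstance,
    ⟨e.trans (PrimeSpectrum.homeomorphOfRingEquiv ULift.ringEquiv.symm)⟩⟩

end SpectralRing

end FUltra

theorem corollary3p2 (X : Type u) [t : TopologicalSpace X] :
    List.TFAE [
      FUltra.IsSpectral.{u, v} X,
      ∃ 𝓑 : Set (Set X), TopologicalSpace.IsTopologicalBasis 𝓑 ∧
        CompactSpace (FUltra.UltraSpace 𝓑) ∧ T2Space (FUltra.UltraSpace 𝓑),
      T0Space X ∧ ∃ 𝓑 : Set (Set X), TopologicalSpace.IsTopologicalBasis 𝓑 ∧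
        ∀ U : Ultrafilter X, (FUltra.limitSet 𝓑 U).Nonempty,
      T0Space X ∧ ∃ 𝓢 : Set (Set X), t = TopologicalSpace.generateFrom 𝓢 ∧
        ∀ U : Ultrafilter X, (FUltra.limitSet 𝓢 U).Nonempty] := by
  tfae_have 1 → 3 := FUltra.IsSpectral.exists_basis
  tfae_have 3 → 2 := fun ⟨h0, 𝓑, h𝓑, hU⟩ =>
    ⟨𝓑, h𝓑, FUltra.compactSpace_ultraSpace_iff.2 hU,
      (FUltra.t2Space_ultraSpace_iff h𝓑.eq_generateFrom).2 h0⟩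
  tfae_have 2 → 3 := fun ⟨𝓑, h𝓑, hc, h2⟩ =>
    ⟨(FUltra.t2Space_ultraSpace_iff h𝓑.eq_generateFrom).1 h2, 𝓑, h𝓑,
      FUltra.compactSpace_ultraSpace_iff.1 hc⟩
  tfae_have 3 → 4 := fun ⟨h0, 𝓑, h𝓑, hU⟩ => ⟨h0, 𝓑, h𝓑.eq_generateFrom, hU⟩
  tfae_have 4 → 1 := fun ⟨_, _, ht, hU⟩ => FUltra.isSpectral_of_generateFrom ht hU
  tfae_finish
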